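/- Let $1<q<2$ and let $p=q/(q-1)\in(2,\infty)$ be the conjugate exponent of $q$. Let $w=(w_n)_{n\ge 1}$ be a sequence of positive real numbers with property $(\ast)$ with respect to $p$: $$w_n\to 0\qquad\text{and}\qquad \sum_{n=1}^\infty w_n^{2p/(p-2)}=\infty .$$ Let $X_{p,w}$ be the Banach space of all real sequences $x=(x_n)$ with $(x_n)\in\ell_p$ and $(x_nw_n)\in\ell_2$, with norm $\|x\|=\max\{\|(x_n)\|_p,\|(x_nw_n)\|_2\}$, let $(e_n)$ be its unit vector basis with biorthogonal functionals $(e_n^*)$, and let $X_{q,w}=X_{p,w}^*$ be its dual space. A Schauder basis $(b_n)$ of a Banach space $X$, with biorthogonal functionals $(b_n^*)$, has the *factorization property* if every bounded linear operator $T\colon X\to X$ with $\inf_n|b_n^*(Tb_n)|>0$ is a factor of the identity, i.e. there are bounded linear operators $A,B\colon X\to X$ with $I=ATB$. **Theorem.** The sequence $(e_n^*)$ is a Schauder basis of $X_{q,w}$, and this basis has the factorization property. -/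

import Mathlib

open Filter Topology
open scoped ENNReal

noncomputable section

/-! ### Factors of the identity and the factorization property of a Schauder basis -/

/-- `T` is a factor of the identity: `I = A T B` for some bounded operators `A`, `B` on `X`. -/
def IsFactorOfIdentity {X : Type*} [NormedAddCommGroup X] [NormedSpace ℝ X]
    (T : X →L[ℝ] X) : Prop :=
  ∃ A B : X →L[ℝ] X, ContinuousLinearMap.id ℝ X = A ∘L T ∘L B

/-- `T` has large diagonal with respect to the Schauder basis `b`:
`inf_n |b_n^*(T b_n)| > 0`. -/
def HasLargeDiagonal {X : Type*} [NormedAddCommGroup X] [NormedSpace ℝ X]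
    (b : SchauderBasis ℝ X) (T : X →L[ℝ] X) : Prop :=
  0 < ⨅ n : ℕ, |b.coord n (T (b n))|

/-- The Schauder basis `b` has the factorization property: every bounded operator with large
diagonal is a factor of the identity. -/
def HasFactorizationProperty {X : Type*} [NormedAddCommGroup X] [NormedSpace ℝ X]
    (b : SchauderBasis ℝ X) : Prop :=
  ∀ T : X →L[ℝ] X, HasLargeDiagonal b T → IsFactorOfIdentity T

/-! ### The space `X_{p,w}` for `2 < p < ∞` -/

/-- The weight condition `(∗)` with respect to `p`: `w` is a sequence of positive reals with
`w_n → 0` and `∑ w_n ^ (2p/(p-2)) = ∞`. -/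
structure StarProperty (p : ℝ) (w : ℕ → ℝ) : Prop where
  pos : ∀ n, 0 < w n
  tendsto_zero : Tendsto w atTop (𝓝 0)
  not_summable : ¬ Summable fun n => w n ^ (2 * p / (p - 2))

/-- The vector space of real sequences `x` with `x ∈ ℓ_p` and `(x_n w_n) ∈ ℓ_2`. -/
def rosenthalSubmodule (p : ℝ) (w : ℕ → ℝ) : Submodule ℝ (ℕ → ℝ) where
  carrier := {x | Memℓp x (ENNReal.ofReal p) ∧ Memℓp (fun n => x n * w n) 2}
  zero_mem' := ⟨zero_memℓp, by simpa using zero_mem_ℓp'⟩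
  add_mem' := fun {x y} hx hy => ⟨hx.1.add hy.1, by
    have h := hx.2.add hy.2
    have e : (fun n => (x + y) n * w n) = (fun n => x n * w n) + (fun n => y n * w n) := by
      ext n; simp [add_mul]
    rw [e]; exact h⟩
  smul_mem' := fun c x hx => ⟨hx.1.const_smul c, by
    have h := hx.2.const_smul c
    have e : (fun n => (c • x) n * w n) = c • (fun n => x n * w n) := by
      ext n; simp [mul_assoc]
    rw [e]; exact h⟩

/-- The space `X_{p,w}`: a copy of `rosenthalSubmodule p w` as a type of its own, so that it
carries the norm below and not the topology of pointwise convergence. -/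
def RosenthalX (p : ℝ) (w : ℕ → ℝ) : Type := rosenthalSubmodule p w

namespace RosenthalX

instance instAddCommGroup (p : ℝ) (w : ℕ → ℝ) : AddCommGroup (RosenthalX p w) :=
  inferInstanceAs (AddCommGroup (rosenthalSubmodule p w))

instance instModule (p : ℝ) (w : ℕ → ℝ) : Module ℝ (RosenthalX p w) :=
  inferInstanceAs (Module ℝ (rosenthalSubmodule p w))

/-- The sequence of coordinates of an element of `X_{p,w}`. -/
def seq {p : ℝ} {w : ℕ → ℝ} (x : RosenthalX p w) : ℕ → ℝ := x.1

instance factOneLe (p : ℝ) [h : Fact (2 < p)] : Fact (1 ≤ ENNReal.ofReal p) :=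
  ⟨by rw [ENNReal.one_le_ofReal]; linarith [h.out]⟩

/-- The map `x ↦ (x, (x_n w_n))` into `ℓ_p × ℓ_2` (with the maximum norm). -/
def toProd (p : ℝ) (w : ℕ → ℝ) :
    RosenthalX p w →ₗ[ℝ] lp (fun _ : ℕ => ℝ) (ENNReal.ofReal p) × lp (fun _ : ℕ => ℝ) 2 where
  toFun x := (⟨x.seq, x.2.1⟩, ⟨fun n => x.seq n * w n, x.2.2⟩)
  map_add' x y := by
    refine Prod.ext (Subtype.ext rfl) (Subtype.ext (funext fun n => ?_))
    exact add_mul (x.seq n) (y.seq n) (w n)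
  map_smul' c x := by
    refine Prod.ext (Subtype.ext rfl) (Subtype.ext (funext fun n => ?_))
    exact mul_assoc c (x.seq n) (w n)

lemma toProd_injective (p : ℝ) (w : ℕ → ℝ) : Function.Injective (toProd p w) := by
  intro x y h
  exact Subtype.ext (congrArg (fun z => (z.1 : ℕ → ℝ)) h)

/-- The norm of `X_{p,w}` is `max (‖(x_n)‖_p) (‖(x_n w_n)‖_2)`; see `norm_eq`. -/
instance instNormedAddCommGroup (p : ℝ) (w : ℕ → ℝ) [Fact (2 < p)] :
    NormedAddCommGroup (RosenthalX p w) :=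
  NormedAddCommGroup.induced _ _ (toProd p w) (toProd_injective p w)

instance instNormedSpace (p : ℝ) (w : ℕ → ℝ) [Fact (2 < p)] : NormedSpace ℝ (RosenthalX p w) :=
  NormedSpace.induced ℝ _ _ (toProd p w)

lemma norm_toProd {p : ℝ} {w : ℕ → ℝ} [Fact (2 < p)] (x : RosenthalX p w) :
    ‖toProd p w x‖ = ‖x‖ := rfl

lemma norm_eq {p : ℝ} {w : ℕ → ℝ} [hp : Fact (2 < p)] (x : RosenthalX p w) :
    ‖x‖ = max ((∑' n, |x.seq n| ^ p) ^ (1 / p)) (√(∑' n, (x.seq n * w n) ^ 2)) := by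
  have hp0 : 0 < p := by linarith [hp.out]
  rw [← norm_toProd, Prod.norm_def,
    lp.norm_eq_tsum_rpow (by rw [ENNReal.toReal_ofReal hp0.le]; exact hp0),
    lp.norm_eq_tsum_rpow (by norm_num), ENNReal.toReal_ofReal hp0.le, Real.sqrt_eq_rpow]
  simp [toProd, mul_pow, sq_abs]

/-- The `n`-th unit vector `e_n` of `X_{p,w}`. -/
def unitVector (p : ℝ) (w : ℕ → ℝ) (n : ℕ) : RosenthalX p w :=
  ⟨Pi.single n 1, by
    have h : ∀ (r : ℝ≥0∞) (v : ℕ → ℝ), Memℓp (fun m => (Pi.single n 1 : ℕ → ℝ) m * v m) r := by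
      intro r v
      refine Memℓp.of_exponent_ge (memℓp_zero ?_) zero_le
      refine (Set.finite_singleton n).subset fun m hm => ?_
      by_contra hmn
      exact hm (by simp [Pi.single_eq_of_ne (by simpa using hmn : m ≠ n)])
    exact ⟨by simpa using h (ENNReal.ofReal p) 1, h 2 w⟩⟩

lemma toProd_unitVector (p : ℝ) (w : ℕ → ℝ) (n : ℕ) (c : ℝ) :
    toProd p w (c • unitVector p w n) =
      (lp.single (ENNReal.ofReal p) n c, lp.single 2 n (c * w n)) := by
  refine Prod.ext (Subtype.ext (funext fun m => ?_)) (Subtype.ext (funext fun m => ?_))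
  · change c * (Pi.single n 1 : ℕ → ℝ) m = (Pi.single n c : ℕ → ℝ) m
    by_cases h : m = n
    · subst h; simp
    · simp [h]
  · change c * (Pi.single n 1 : ℕ → ℝ) m * w m = (Pi.single n (c * w n) : ℕ → ℝ) m
    by_cases h : m = n
    · subst h; simp
    · simp [h]

/-- The `n`-th coordinate functional `e_n^*` of `X_{p,w}`. -/
def coordFunctional (p : ℝ) (w : ℕ → ℝ) [hp : Fact (2 < p)] (n : ℕ) :
    StrongDual ℝ (RosenthalX p w) :=
  LinearMap.mkContinuous
    { toFun := fun x => x.seq n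
      map_add' := fun _ _ => rfl
      map_smul' := fun _ _ => rfl } 1 fun x => by
    have hp0 : ENNReal.ofReal p ≠ 0 := by
      simpa using (by linarith [hp.out] : (0 : ℝ) < p)
    rw [one_mul, ← norm_toProd]
    exact (lp.norm_apply_le_norm hp0 (toProd p w x).1 n).trans (norm_fst_le _)

lemma hasSum_unitVector (p : ℝ) (w : ℕ → ℝ) [hp : Fact (2 < p)] (x : RosenthalX p w) :
    HasSum (fun n => x.seq n • unitVector p w n) x := by
  have hind : Topology.IsInducing (toProd p w) := ⟨rfl⟩
  rw [← hind.hasSum_iff]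
  have h1 := lp.hasSum_single (p := ENNReal.ofReal p) ENNReal.ofReal_ne_top (toProd p w x).1
  have h2 := lp.hasSum_single (p := (2 : ℝ≥0∞)) (by simp) (toProd p w x).2
  have h3 := h1.prodMk h2
  convert h3 using 1
  exact funext fun n => toProd_unitVector p w n (x.seq n)

/-- The unit vector basis `(e_n)` of `X_{p,w}`, with its biorthogonal functionals `(e_n^*)`. -/
def unitVectorBasis (p : ℝ) (w : ℕ → ℝ) [Fact (2 < p)] : SchauderBasis ℝ (RosenthalX p w) where
  basis := unitVector p w
  coord := coordFunctional p w
  ortho i j := by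
    change (Pi.single j 1 : ℕ → ℝ) i = _
    by_cases h : i = j
    · subst h; simp
    · simp [h]
  expansion x := Tendsto.mono_left (hasSum_unitVector p w x)
    (SummationFilter.LeAtTop.le_atTop (L := SummationFilter.conditional ℕ))

end RosenthalX

end

/-!
Write `X` for `X_{p,w}`, `e_n` for its unit vectors and `e_n^*` for their biorthogonal functionals.

The dual side is reduced to `X` itself. As `p ≥ 2`, the norm of `X` satisfies an upper `2`-estimate
on disjointly supported vectors (`RosenthalX.norm_add_sq_le_of_disjoint`). A functional therefore
cannot keep a fixed size on vectors supported arbitrarily far out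
(`RosenthalX.exists_finset_abs_apply_le`), which makes `(e_n^*)` a basis of the dual
(`RosenthalX.dualBasis`). Since `(e_n)` is also boundedly complete (`RosenthalX.exists_seq_eq`), `X`
is reflexive, every operator on the dual is an adjoint `S^*` with the same diagonal as `S`, and a
factorization `I = A S B` dualizes to `I = B^* S^* A^*`.

For an operator `S` on `X` with large diagonal, passing to `-S` if necessary, the diagonal is at
least `δ` on a set `N` with `∑_{n ∈ N} w_n ^ (2p/(p-2)) = ∞`. With `θ_n = w_n ^ (2/(p-2))` one has
`θ_n ^ p = (θ_n w_n) ^ 2 = w_n ^ (2p/(p-2))`; if `s` is the sum of these numbers over a finite set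
`E`, a vector `s ^ (-1/p) ∑_{n ∈ E} ±θ_n e_n` has norm `1` in `ℓ_p` and `s ^ (1/2 - 1/p)` in the
weighted `ℓ_2`, and it is the range of a projection bounded for both norms
(`RosenthalX.isAdapted_of_sum_mem_Icc`). Because the terms tend to zero and their sum over `N`
diverges, `E ⊂ N` can be taken off any finite set and with `s ^ (1/2 - 1/p)` comparable to any given
weight; a suitable choice of the signs keeps the diagonal entry of `S` at the block at least `δ`
(`RosenthalX.exists_block`).

Disjoint blocks with weights comparable to `w_0, w_1, …`, chosen by a gliding hump, span a
complemented copy of `X` on which the compression of `S` has diagonal at least `δ` and summably small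
off-diagonal entries. A Neumann series inverts it
(`RosenthalX.exists_leftInverse_of_small_offDiagonal`), and this factors the identity through `S`.
-/

namespace RosenthalX

variable {p : ℝ} {w : ℕ → ℝ}

/-! ### Coordinates and the norm of `X_{p,w}` -/

@[simp] lemma seq_add (x y : RosenthalX p w) (n : ℕ) : (x + y).seq n = x.seq n + y.seq n := rfl

@[simp] lemma seq_smul (c : ℝ) (x : RosenthalX p w) (n : ℕ) : (c • x).seq n = c * x.seq n := rfl

@[simp] lemma seq_sub (x y : RosenthalX p w) (n : ℕ) : (x - y).seq n = x.seq n - y.seq n := rfl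

@[simp] lemma seq_zero (n : ℕ) : (0 : RosenthalX p w).seq n = 0 := rfl

lemma seq_sum (F : Finset ℕ) (f : ℕ → RosenthalX p w) (n : ℕ) :
    (∑ i ∈ F, f i).seq n = ∑ i ∈ F, (f i).seq n := by
  classical
  induction F using Finset.induction_on with
  | empty => simp
  | insert i F hi ih => simp [Finset.sum_insert hi, ih]

lemma seq_unitVector (m n : ℕ) : (unitVector p w m).seq n = if n = m then 1 else 0 := by
  change (Pi.single m 1 : ℕ → ℝ) n = _
  simp [Pi.single_apply]

lemma seq_sum_smul_unitVector (F : Finset ℕ) (y : ℕ → ℝ) (n : ℕ) :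
    (∑ i ∈ F, y i • unitVector p w i).seq n = if n ∈ F then y n else 0 := by
  simp [seq_sum, seq_unitVector]

lemma seq_injective {x y : RosenthalX p w} (h : ∀ n, x.seq n = y.seq n) : x = y :=
  Subtype.ext (funext h)

section Norm

variable [hp : Fact (2 < p)]

lemma toReal_ofReal_exponent : (ENNReal.ofReal p).toReal = p :=
  ENNReal.toReal_ofReal (by linarith [hp.out])

@[simp] lemma coordFunctional_apply (n : ℕ) (x : RosenthalX p w) :
    coordFunctional p w n x = x.seq n := rfl

lemma sum_rpow_le_norm_rpow (x : RosenthalX p w) (F : Finset ℕ) :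
    ∑ n ∈ F, |x.seq n| ^ p ≤ ‖x‖ ^ p := by
  have hp0 : 0 < p := by linarith [hp.out]
  have h := lp.sum_rpow_le_norm_rpow (p := ENNReal.ofReal p)
    (by rwa [toReal_ofReal_exponent]) (toProd p w x).1 F
  rw [toReal_ofReal_exponent] at h
  refine h.trans (Real.rpow_le_rpow (norm_nonneg _) ?_ hp0.le)
  rw [← norm_toProd]
  exact norm_fst_le _

lemma sum_sq_le_norm_sq (x : RosenthalX p w) (F : Finset ℕ) :
    ∑ n ∈ F, (x.seq n * w n) ^ 2 ≤ ‖x‖ ^ 2 := by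
  have h := lp.sum_rpow_le_norm_rpow (p := 2) (by norm_num) (toProd p w x).2 F
  simp only [ENNReal.toReal_ofNat, Real.rpow_ofNat, Real.norm_eq_abs, sq_abs] at h
  refine h.trans (pow_le_pow_left₀ (norm_nonneg _) ?_ 2)
  rw [← norm_toProd]
  exact norm_snd_le _

lemma norm_le_of_forall_sum_le {x : RosenthalX p w} {C : ℝ} (hC : 0 ≤ C)
    (h₁ : ∀ F : Finset ℕ, ∑ n ∈ F, |x.seq n| ^ p ≤ C ^ p)
    (h₂ : ∀ F : Finset ℕ, ∑ n ∈ F, (x.seq n * w n) ^ 2 ≤ C ^ 2) : ‖x‖ ≤ C := by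
  have hp0 : 0 < p := by linarith [hp.out]
  rw [← norm_toProd, Prod.norm_def]
  refine max_le ?_ ?_
  · refine lp.norm_le_of_forall_sum_le (p := ENNReal.ofReal p)
      (by rwa [toReal_ofReal_exponent]) hC fun F => ?_
    rw [toReal_ofReal_exponent]
    exact h₁ F
  · refine lp.norm_le_of_forall_sum_le (p := 2) (by norm_num) hC fun F => ?_
    simp only [ENNReal.toReal_ofNat, Real.rpow_ofNat, Real.norm_eq_abs, sq_abs]
    exact h₂ F

/-- Norm bounds on the finite sections of a sequence put the sequence into `X_{p,w}`: the unit
vector basis is boundedly complete. -/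
lemma exists_seq_eq {y : ℕ → ℝ} {C : ℝ} (hC : 0 ≤ C)
    (h₁ : ∀ F : Finset ℕ, ∑ n ∈ F, |y n| ^ p ≤ C ^ p)
    (h₂ : ∀ F : Finset ℕ, ∑ n ∈ F, (y n * w n) ^ 2 ≤ C ^ 2) :
    ∃ x : RosenthalX p w, x.seq = y ∧ ‖x‖ ≤ C := by
  have m₁ : Memℓp y (ENNReal.ofReal p) := memℓp_gen' (C := C ^ p) fun F => by
    rw [toReal_ofReal_exponent]
    exact h₁ F
  have m₂ : Memℓp (fun n => y n * w n) 2 := memℓp_gen' (C := C ^ 2) fun F => by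
    simpa only [ENNReal.toReal_ofNat, Real.rpow_ofNat, Real.norm_eq_abs, sq_abs] using h₂ F
  exact ⟨⟨y, m₁, m₂⟩, rfl, norm_le_of_forall_sum_le hC h₁ h₂⟩

/-- A linear map from `X_{p,w}` to sequences that satisfies the two norm bounds on finite sections
is a bounded operator on `X_{p,w}`. -/
lemma exists_continuousLinearMap (L : RosenthalX p w →ₗ[ℝ] (ℕ → ℝ)) {C : ℝ} (hC : 0 ≤ C)
    (h₁ : ∀ x, ∀ F : Finset ℕ, ∑ n ∈ F, |L x n| ^ p ≤ (C * ‖x‖) ^ p)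
    (h₂ : ∀ x, ∀ F : Finset ℕ, ∑ n ∈ F, (L x n * w n) ^ 2 ≤ (C * ‖x‖) ^ 2) :
    ∃ M : RosenthalX p w →L[ℝ] RosenthalX p w, ∀ x n, (M x).seq n = L x n := by
  choose M hM hMC using fun x =>
    exists_seq_eq (mul_nonneg hC (norm_nonneg x)) (h₁ x) (h₂ x)
  refine ⟨LinearMap.mkContinuous
    { toFun := M
      map_add' := fun x y => seq_injective fun n => ?_
      map_smul' := fun c x => seq_injective fun n => ?_ } C hMC, fun x n => congrFun (hM x) n⟩
  · simp [hM]
  · simp [hM]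

lemma abs_seq_le_norm (x : RosenthalX p w) (n : ℕ) : |x.seq n| ≤ ‖x‖ := by
  have hp0 : 0 < p := by linarith [hp.out]
  have h := sum_rpow_le_norm_rpow x {n}
  rw [Finset.sum_singleton] at h
  exact (Real.rpow_le_rpow_iff (abs_nonneg _) (norm_nonneg _) hp0).1 h

lemma norm_mono {x y : RosenthalX p w} (h : ∀ n, |x.seq n| ≤ |y.seq n|) : ‖x‖ ≤ ‖y‖ := by
  have hp0 : 0 < p := by linarith [hp.out]
  refine norm_le_of_forall_sum_le (norm_nonneg _) (fun F => ?_) fun F => ?_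
  · exact (Finset.sum_le_sum fun n _ => Real.rpow_le_rpow (abs_nonneg _) (h n) hp0.le).trans
      (sum_rpow_le_norm_rpow y F)
  · refine (Finset.sum_le_sum fun n _ => ?_).trans (sum_sq_le_norm_sq y F)
    rw [mul_pow, mul_pow]
    exact mul_le_mul_of_nonneg_right (sq_le_sq.2 (h n)) (sq_nonneg _)

lemma norm_unitVector_le {W : ℝ} (hW : 1 ≤ W) (hw : ∀ n, |w n| ≤ W) (m : ℕ) :
    ‖unitVector p w m‖ ≤ W := by
  have hp0 : 0 < p := by linarith [hp.out]
  refine norm_le_of_forall_sum_le (by linarith) (fun F => ?_) fun F => ?_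
  · have : ∀ n, |(unitVector p w m).seq n| ^ p = if n = m then 1 else 0 := fun n => by
      rw [seq_unitVector]
      split_ifs <;> simp [hp0.ne']
    rw [Finset.sum_congr rfl fun n _ => this n, Finset.sum_ite_eq']
    have := Real.one_le_rpow hW hp0.le
    split_ifs <;> linarith
  · have : ∀ n, ((unitVector p w m).seq n * w n) ^ 2 = if n = m then w m ^ 2 else 0 := fun n => by
      rw [seq_unitVector]
      split_ifs with h <;> simp [h]
    rw [Finset.sum_congr rfl fun n _ => this n, Finset.sum_ite_eq']
    have h2 : w m ^ 2 ≤ W ^ 2 := sq_le_sq.2 ((hw m).trans (le_abs_self W))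
    split_ifs
    · exact h2
    · positivity

/-- The upper `2`-estimate of `X_{p,w}`, which holds because `p ≥ 2`. -/
lemma norm_add_sq_le_of_disjoint {x y : RosenthalX p w} (h : ∀ n, x.seq n = 0 ∨ y.seq n = 0) :
    ‖x + y‖ ^ 2 ≤ ‖x‖ ^ 2 + ‖y‖ ^ 2 := by
  have hp2 : 2 < p := hp.out
  have hp0 : 0 < p := by linarith
  have h0 : 0 ≤ ‖x‖ ^ 2 + ‖y‖ ^ 2 := by positivity
  have key : ‖x + y‖ ≤ √(‖x‖ ^ 2 + ‖y‖ ^ 2) := by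
    refine norm_le_of_forall_sum_le (Real.sqrt_nonneg _) (fun F => ?_) fun F => ?_
    · have e : ∀ n, |(x + y).seq n| ^ p = |x.seq n| ^ p + |y.seq n| ^ p := fun n => by
        rcases h n with h | h <;> simp [h, hp0.ne']
      have e2 : ∀ z : RosenthalX p w, (‖z‖ ^ 2) ^ (p / 2) = ‖z‖ ^ p := fun z => by
        rw [← Real.rpow_natCast, ← Real.rpow_mul (norm_nonneg _)]
        congr 1
        push_cast
        ring
      have e3 : √(‖x‖ ^ 2 + ‖y‖ ^ 2) ^ p = (‖x‖ ^ 2 + ‖y‖ ^ 2) ^ (p / 2) := by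
        rw [Real.sqrt_eq_rpow, ← Real.rpow_mul h0]
        congr 1
        ring
      rw [Finset.sum_congr rfl fun n _ => e n, Finset.sum_add_distrib, e3]
      refine (add_le_add (sum_rpow_le_norm_rpow x F) (sum_rpow_le_norm_rpow y F)).trans ?_
      rw [← e2, ← e2]
      exact Real.add_rpow_le_rpow_add (by positivity) (by positivity) (by linarith)
    · have e : ∀ n, ((x + y).seq n * w n) ^ 2 = (x.seq n * w n) ^ 2 + (y.seq n * w n) ^ 2 :=
        fun n => by rcases h n with h | h <;> simp [h]
      rw [Finset.sum_congr rfl fun n _ => e n, Finset.sum_add_distrib, Real.sq_sqrt h0]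
      exact add_le_add (sum_sq_le_norm_sq x F) (sum_sq_le_norm_sq y F)
  calc ‖x + y‖ ^ 2 ≤ √(‖x‖ ^ 2 + ‖y‖ ^ 2) ^ 2 := pow_le_pow_left₀ (norm_nonneg _) key 2
    _ = _ := Real.sq_sqrt h0

/-! ### The dual basis and reflexivity -/

lemma norm_section_le (x : RosenthalX p w) (F : Finset ℕ) :
    ‖∑ i ∈ F, x.seq i • unitVector p w i‖ ≤ ‖x‖ :=
  norm_mono fun n => by
    rw [seq_sum_smul_unitVector]
    split_ifs <;> simp

lemma norm_sub_section_le (x : RosenthalX p w) (F : Finset ℕ) :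
    ‖x - ∑ i ∈ F, x.seq i • unitVector p w i‖ ≤ ‖x‖ :=
  norm_mono fun n => by
    rw [seq_sub, seq_sum_smul_unitVector]
    split_ifs <;> simp

/-- Every functional is small on vectors supported off a suitable finite set: the unit vector
basis is shrinking. For a vector `y` that almost norms `ξ` and `x` disjoint from `y`, the upper
`2`-estimate makes `‖y + t x‖` at most `1 + t² / 2`, so that `ξ x` cannot be large. -/
lemma exists_finset_abs_apply_le (ξ : StrongDual ℝ (RosenthalX p w)) {ε : ℝ} (hε : 0 < ε) :
    ∃ F : Finset ℕ, ∀ x : RosenthalX p w, (∀ n ∈ F, x.seq n = 0) → |ξ x| ≤ ε * ‖x‖ := by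
  set t : ℝ := ε / (‖ξ‖ + 1) with ht
  have hξ : 0 ≤ ‖ξ‖ := norm_nonneg ξ
  have ht0 : 0 < t := by positivity
  have htξ : ‖ξ‖ * t ≤ ε := by
    rw [ht, mul_div_assoc', div_le_iff₀ (by positivity)]
    nlinarith
  obtain ⟨y, hy1, hy⟩ : ∃ y : RosenthalX p w, ‖y‖ ≤ 1 ∧ ‖ξ‖ - t * ε / 2 < ξ y := by
    by_contra! hcon
    have h0 : 0 ≤ ‖ξ‖ - t * ε / 2 := by simpa using hcon 0 (by simp)
    have hle : ‖ξ‖ ≤ ‖ξ‖ - t * ε / 2 := by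
      refine ξ.opNorm_le_of_unit_norm h0 fun x hx => ?_
      rw [Real.norm_eq_abs, abs_le]
      have h1 := hcon x hx.le
      have h2 := hcon (-x) (by rw [norm_neg]; exact hx.le)
      rw [map_neg] at h2
      constructor <;> linarith
    have : 0 < t * ε / 2 := by positivity
    linarith
  have hlim : Tendsto (fun F : Finset ℕ => ξ (∑ i ∈ F, y.seq i • unitVector p w i)) atTop
      (𝓝 (ξ y)) := (ξ.continuous.tendsto y).comp (hasSum_unitVector p w y)
  obtain ⟨F, hF⟩ := (hlim.eventually (lt_mem_nhds hy)).exists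
  refine ⟨F, ?_⟩
  -- One-sided bound for unit vectors; the general case follows by scaling.
  have unit_bound : ∀ x : RosenthalX p w, (∀ n ∈ F, x.seq n = 0) → ‖x‖ = 1 → ξ x ≤ ε := by
    intro x hx hx1
    set y' := ∑ i ∈ F, y.seq i • unitVector p w i with hy'
    have hy'1 : ‖y'‖ ≤ 1 := (norm_section_le y F).trans hy1
    have hsq : ‖y' + t • x‖ ^ 2 ≤ 1 + t ^ 2 := by
      refine (norm_add_sq_le_of_disjoint fun n => ?_).trans ?_
      · by_cases hn : n ∈ F
        · right; simp [hx n hn]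
        · left; rw [hy', seq_sum_smul_unitVector, if_neg hn]
      · rw [norm_smul, hx1, Real.norm_eq_abs, mul_one, sq_abs]
        have : ‖y'‖ ^ 2 ≤ 1 := pow_le_one₀ (norm_nonneg _) hy'1
        linarith
    have hnorm : ‖y' + t • x‖ ≤ 1 + t ^ 2 / 2 := by
      nlinarith [sq_nonneg (‖y' + t • x‖ - 1)]
    have h1 : ξ y' + t * ξ x ≤ ‖ξ‖ * (1 + t ^ 2 / 2) := by
      calc ξ y' + t * ξ x = ξ (y' + t • x) := by simp
        _ ≤ ‖ξ (y' + t • x)‖ := le_abs_self _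
        _ ≤ ‖ξ‖ * ‖y' + t • x‖ := ξ.le_opNorm _
        _ ≤ _ := mul_le_mul_of_nonneg_left hnorm hξ
    have h2 : t * ξ x ≤ t * ε := by nlinarith
    exact le_of_mul_le_mul_left h2 ht0
  have upper : ∀ x : RosenthalX p w, (∀ n ∈ F, x.seq n = 0) → ξ x ≤ ε * ‖x‖ := by
    intro x hx
    rcases eq_or_ne x 0 with rfl | hx0
    · simp
    · have hn : 0 < ‖x‖ := norm_pos_iff.2 hx0
      have h := unit_bound (‖x‖⁻¹ • x) (fun n hn => by simp [hx n hn])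
        (by rw [norm_smul, norm_inv, norm_norm, inv_mul_cancel₀ hn.ne'])
      rw [map_smul, smul_eq_mul, inv_mul_le_iff₀ hn] at h
      linarith
  intro x hx
  refine abs_le.2 ⟨?_, upper x hx⟩
  have h := upper ((-1 : ℝ) • x) fun n hn => by rw [seq_smul, hx n hn, mul_zero]
  rw [map_smul, norm_smul, norm_neg, norm_one, one_mul, smul_eq_mul] at h
  linarith

lemma hasSum_coordFunctional (ξ : StrongDual ℝ (RosenthalX p w)) :
    HasSum (fun n => ξ (unitVector p w n) • coordFunctional p w n) ξ := by
  classical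
  refine Metric.tendsto_atTop.2 fun ε hε => ?_
  obtain ⟨F, hF⟩ := exists_finset_abs_apply_le ξ (half_pos hε)
  refine ⟨F, fun G hG => ?_⟩
  rw [dist_comm, dist_eq_norm]
  refine lt_of_le_of_lt (ContinuousLinearMap.opNorm_le_bound _ (half_pos hε).le fun x => ?_)
    (half_lt_self hε)
  have e : (ξ - ∑ n ∈ G, ξ (unitVector p w n) • coordFunctional p w n) x =
      ξ (x - ∑ n ∈ G, x.seq n • unitVector p w n) := by
    simp [mul_comm]
  rw [e, Real.norm_eq_abs]
  refine (hF _ fun n hn => ?_).trans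
    (mul_le_mul_of_nonneg_left (norm_sub_section_le x G) (half_pos hε).le)
  rw [seq_sub, seq_sum_smul_unitVector, if_pos (hG hn), sub_self]

/-- The biorthogonal functionals `(e_n^*)` as a Schauder basis of the dual of `X_{p,w}`; the
coordinate functionals are the evaluations at the unit vectors. -/
noncomputable def dualBasis (p : ℝ) (w : ℕ → ℝ) [Fact (2 < p)] :
    SchauderBasis ℝ (StrongDual ℝ (RosenthalX p w)) where
  basis := coordFunctional p w
  coord n := NormedSpace.inclusionInDoubleDual ℝ _ (unitVector p w n)
  ortho i j := by
    rw [NormedSpace.dual_def, coordFunctional_apply, seq_unitVector]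
    by_cases h : i = j
    · subst h; simp
    · simp [h, Ne.symm h]
  expansion ξ := Tendsto.mono_left (hasSum_coordFunctional ξ)
    (SummationFilter.LeAtTop.le_atTop (L := SummationFilter.conditional ℕ))

/-- `X_{p,w}` is reflexive. -/
lemma inclusionInDoubleDual_surjective :
    Function.Surjective (NormedSpace.inclusionInDoubleDualLi ℝ (E := RosenthalX p w)) := by
  intro φ
  have hp0 : 0 < p := by linarith [hp.out]
  set y : ℕ → ℝ := fun n => φ (coordFunctional p w n) with hy
  have bound : ∀ F : Finset ℕ, ‖∑ n ∈ F, y n • unitVector p w n‖ ≤ ‖φ‖ := by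
    intro F
    obtain ⟨η, hη1, hη⟩ := exists_dual_vector'' ℝ (∑ n ∈ F, y n • unitVector p w n)
    have e : η (∑ n ∈ F, y n • unitVector p w n) =
        φ (∑ n ∈ F, η (unitVector p w n) • coordFunctional p w n) := by
      simp [hy, mul_comm]
    have hnorm : ‖∑ n ∈ F, η (unitVector p w n) • coordFunctional p w n‖ ≤ 1 := by
      refine ContinuousLinearMap.opNorm_le_bound _ zero_le_one fun x => ?_
      have e' : (∑ n ∈ F, η (unitVector p w n) • coordFunctional p w n) x =
          η (∑ n ∈ F, x.seq n • unitVector p w n) := by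
        simp [mul_comm]
      rw [e']
      exact (η.le_opNorm _).trans
        (mul_le_mul hη1 (norm_section_le x F) (norm_nonneg _) zero_le_one)
    calc ‖∑ n ∈ F, y n • unitVector p w n‖ = η (∑ n ∈ F, y n • unitVector p w n) := by
          rw [hη]; rfl
      _ = φ (∑ n ∈ F, η (unitVector p w n) • coordFunctional p w n) := e
      _ ≤ ‖φ (∑ n ∈ F, η (unitVector p w n) • coordFunctional p w n)‖ := le_abs_self _
      _ ≤ ‖φ‖ * 1 := (φ.le_opNorm _).trans (mul_le_mul_of_nonneg_left hnorm (norm_nonneg _))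
      _ = ‖φ‖ := mul_one _
  obtain ⟨x, hx, -⟩ := exists_seq_eq (p := p) (w := w) (y := y) (norm_nonneg φ)
    (fun F => by
      refine le_trans (le_of_eq (Finset.sum_congr rfl fun n hn => ?_))
        ((sum_rpow_le_norm_rpow (∑ n ∈ F, y n • unitVector p w n) F).trans
          (Real.rpow_le_rpow (norm_nonneg _) (bound F) hp0.le))
      rw [seq_sum_smul_unitVector, if_pos hn])
    (fun F => by
      refine le_trans (le_of_eq (Finset.sum_congr rfl fun n hn => ?_))
        ((sum_sq_le_norm_sq (∑ n ∈ F, y n • unitVector p w n) F).trans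
          (pow_le_pow_left₀ (norm_nonneg _) (bound F) 2))
      rw [seq_sum_smul_unitVector, if_pos hn])
  refine ⟨x, ContinuousLinearMap.ext fun ξ => ?_⟩
  have h1 := (hasSum_coordFunctional ξ).mapL φ
  have h2 := (hasSum_unitVector p w x).mapL ξ
  refine h2.unique ?_
  convert h1 using 1
  funext n
  simp [hx, hy, mul_comm]

instance instCompleteSpace : CompleteSpace (RosenthalX p w) :=
  let e := LinearIsometryEquiv.ofSurjective
    (NormedSpace.inclusionInDoubleDualLi ℝ (E := RosenthalX p w)) inclusionInDoubleDual_surjective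
  (completeSpace_congr (e := e.toEquiv) e.isometry.isUniformEmbedding).2 inferInstance

/-- By reflexivity every operator on the dual of `X_{p,w}` is an adjoint. -/
lemma exists_preadjoint (T : StrongDual ℝ (RosenthalX p w) →L[ℝ] StrongDual ℝ (RosenthalX p w)) :
    ∃ S : RosenthalX p w →L[ℝ] RosenthalX p w, ∀ ξ x, T ξ x = ξ (S x) := by
  let e := LinearIsometryEquiv.ofSurjective
    (NormedSpace.inclusionInDoubleDualLi ℝ (E := RosenthalX p w)) inclusionInDoubleDual_surjective
  let T' : StrongDual ℝ (StrongDual ℝ (RosenthalX p w)) →L[ℝ]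
      StrongDual ℝ (StrongDual ℝ (RosenthalX p w)) := ContinuousLinearMap.precomp ℝ T
  refine ⟨e.symm.toContinuousLinearEquiv.toContinuousLinearMap ∘L T' ∘L
    e.toContinuousLinearEquiv.toContinuousLinearMap, fun ξ x => ?_⟩
  have h : e (e.symm (T' (e x))) ξ = T' (e x) ξ := by rw [e.apply_symm_apply]
  exact h.symm

end Norm

/-! ### Blocks -/

/-- The data of a block: a finite set `support ⊂ ℕ`, the coefficients `left` of the functional
`∑ left n • e_n^*` and the coefficients `right` of the vector `∑ right n • e_n`, both sums over the
support. -/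
structure Block where
  /-- The indices over which the block extends. -/
  support : Finset ℕ
  /-- The coefficients of the functional of the block. -/
  left : ℕ → ℝ
  /-- The coefficients of the vector of the block. -/
  right : ℕ → ℝ

namespace Block

/-- The vector of a block. -/
noncomputable def vector (p : ℝ) (w : ℕ → ℝ) (B : Block) : RosenthalX p w :=
  ∑ n ∈ B.support, B.right n • unitVector p w n

/-- The functional of a block. -/
noncomputable def functional (p : ℝ) (w : ℕ → ℝ) [Fact (2 < p)] (B : Block) :
    StrongDual ℝ (RosenthalX p w) :=
  ∑ n ∈ B.support, B.left n • coordFunctional p w n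

/-- A block is adapted to the weight `v > 0` if its vector has norm at most `1` in `ℓ_p` and at most
`2 v` in the weighted `ℓ_2`, and its functional has norm at most `1` on `ℓ_p` and at most `1 / v` on
the weighted `ℓ_2`. Up to constants, these are the norms of a unit vector with weight `v` and of its
coordinate functional. -/
structure IsAdapted (p : ℝ) (w : ℕ → ℝ) (v : ℝ) (B : Block) : Prop where
  right_eq_zero : ∀ n, n ∉ B.support → B.right n = 0
  sum_right_rpow_le : ∑ n ∈ B.support, |B.right n| ^ p ≤ 1
  sum_right_sq_le : ∑ n ∈ B.support, (B.right n * w n) ^ 2 ≤ (2 * v) ^ 2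
  left_rpow_le : ∀ x : ℕ → ℝ,
    |∑ n ∈ B.support, B.left n * x n| ^ p ≤ ∑ n ∈ B.support, |x n| ^ p
  left_sq_le : ∀ x : ℕ → ℝ,
    ((∑ n ∈ B.support, B.left n * x n) * v) ^ 2 ≤ ∑ n ∈ B.support, (x n * w n) ^ 2

lemma functional_apply [Fact (2 < p)] (B : Block) (x : RosenthalX p w) :
    B.functional p w x = ∑ n ∈ B.support, B.left n * x.seq n := by
  simp [functional]

lemma IsAdapted.seq_vector {B : Block} {v : ℝ} (hB : B.IsAdapted p w v) (n : ℕ) :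
    (B.vector p w).seq n = B.right n := by
  rw [vector, seq_sum_smul_unitVector]
  split_ifs with h
  · rfl
  · exact (hB.right_eq_zero n h).symm

lemma IsAdapted.abs_functional_le [hp : Fact (2 < p)] {B : Block} {v : ℝ}
    (hB : B.IsAdapted p w v) (x : RosenthalX p w) : |B.functional p w x| ≤ ‖x‖ := by
  have hp0 : 0 < p := by linarith [hp.out]
  rw [← Real.rpow_le_rpow_iff (abs_nonneg _) (norm_nonneg _) hp0, functional_apply]
  exact (hB.left_rpow_le x.seq).trans (sum_rpow_le_norm_rpow x _)

lemma IsAdapted.sum_right_rpow_le_of_finset {B : Block} {v : ℝ} (hp0 : 0 < p)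
    (hB : B.IsAdapted p w v) (F : Finset ℕ) : ∑ n ∈ F, |B.right n| ^ p ≤ 1 := by
  classical
  refine le_trans ?_ hB.sum_right_rpow_le
  rw [← Finset.sum_subset (Finset.inter_subset_left (s₁ := F) (s₂ := B.support)) fun n hn hn' => ?_]
  · exact Finset.sum_le_sum_of_subset_of_nonneg Finset.inter_subset_right
      fun n _ _ => Real.rpow_nonneg (abs_nonneg _) _
  · rw [hB.right_eq_zero n fun h => hn' (Finset.mem_inter.2 ⟨hn, h⟩), abs_zero,
      Real.zero_rpow hp0.ne']

lemma IsAdapted.sum_right_sq_le_of_finset {B : Block} {v : ℝ}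
    (hB : B.IsAdapted p w v) (F : Finset ℕ) :
    ∑ n ∈ F, (B.right n * w n) ^ 2 ≤ (2 * v) ^ 2 := by
  classical
  refine le_trans ?_ hB.sum_right_sq_le
  rw [← Finset.sum_subset (Finset.inter_subset_left (s₁ := F) (s₂ := B.support)) fun n hn hn' => ?_]
  · exact Finset.sum_le_sum_of_subset_of_nonneg Finset.inter_subset_right
      fun n _ _ => sq_nonneg _
  · rw [hB.right_eq_zero n fun h => hn' (Finset.mem_inter.2 ⟨hn, h⟩)]
    simp

lemma IsAdapted.norm_vector_le [hp : Fact (2 < p)] {B : Block} {v W : ℝ}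
    (hB : B.IsAdapted p w v) (hW : 1 ≤ W) (hv : |v| ≤ W) : ‖B.vector p w‖ ≤ 2 * W := by
  have hp0 : 0 < p := by linarith [hp.out]
  refine norm_le_of_forall_sum_le (by linarith) (fun F => ?_) fun F => ?_ <;>
    simp only [hB.seq_vector]
  · exact (hB.sum_right_rpow_le_of_finset hp0 F).trans
      (Real.one_le_rpow (by linarith) hp0.le)
  · refine (hB.sum_right_sq_le_of_finset F).trans (sq_le_sq.2 ?_)
    rw [abs_mul, abs_mul]
    exact mul_le_mul_of_nonneg_left (hv.trans (le_abs_self W)) (abs_nonneg _)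

end Block

/-! ### Operators built from blocks, and almost diagonal operators -/

section Operators

variable [hp : Fact (2 < p)] {B : ℕ → Block}

/-- The operator that maps the unit vectors to the vectors of a disjoint sequence of blocks. -/
lemma exists_synthesis (hB : ∀ j, (B j).IsAdapted p w (w j))
    (hdisj : Pairwise fun i j => Disjoint (B i).support (B j).support) :
    ∃ J : RosenthalX p w →L[ℝ] RosenthalX p w,
      ∀ j, J (unitVector p w j) = (B j).vector p w := by
  classical
  have hp0 : 0 < p := by linarith [hp.out]
  -- `κ n` is the index of the block that contains `n`, and arbitrary if there is none.
  obtain ⟨κ, hκ⟩ : ∃ κ : ℕ → ℕ, ∀ j, ∀ n ∈ (B j).support, κ n = j := by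
    refine ⟨fun n => if h : ∃ j, n ∈ (B j).support then h.choose else 0, fun j n hn => ?_⟩
    have h : ∃ j, n ∈ (B j).support := ⟨j, hn⟩
    simp only [dif_pos h]
    by_contra hne
    exact Finset.disjoint_left.1 (hdisj hne) h.choose_spec hn
  let L : RosenthalX p w →ₗ[ℝ] (ℕ → ℝ) :=
    { toFun := fun x n => (B (κ n)).right n * x.seq (κ n)
      map_add' := fun x y => funext fun n => by simp [mul_add]
      map_smul' := fun c x => funext fun n => by simp [mul_left_comm] }
  obtain ⟨J, hJ⟩ := exists_continuousLinearMap L zero_le_two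
    (fun x F => by
      calc ∑ n ∈ F, |L x n| ^ p
          = ∑ n ∈ F, |(B (κ n)).right n| ^ p * |x.seq (κ n)| ^ p :=
            Finset.sum_congr rfl fun n _ => by
              change |(B (κ n)).right n * x.seq (κ n)| ^ p = _
              rw [abs_mul, Real.mul_rpow (abs_nonneg _) (abs_nonneg _)]
        _ = ∑ j ∈ F.image κ, ∑ n ∈ F with κ n = j,
              |(B (κ n)).right n| ^ p * |x.seq (κ n)| ^ p :=
            (Finset.sum_fiberwise_of_maps_to (fun n hn => Finset.mem_image_of_mem κ hn) _).symm
        _ ≤ ∑ j ∈ F.image κ, |x.seq j| ^ p := Finset.sum_le_sum fun j _ => by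
            have e : ∑ n ∈ F with κ n = j, |(B (κ n)).right n| ^ p * |x.seq (κ n)| ^ p =
                (∑ n ∈ F with κ n = j, |(B j).right n| ^ p) * |x.seq j| ^ p := by
              rw [Finset.sum_mul]
              refine Finset.sum_congr rfl fun n hn => ?_
              rw [(Finset.mem_filter.1 hn).2]
            rw [e]
            exact mul_le_of_le_one_left (Real.rpow_nonneg (abs_nonneg _) _)
              ((hB j).sum_right_rpow_le_of_finset hp0 _)
        _ ≤ ‖x‖ ^ p := sum_rpow_le_norm_rpow x _
        _ ≤ (2 * ‖x‖) ^ p := Real.rpow_le_rpow (norm_nonneg _)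
            (by linarith [norm_nonneg x]) hp0.le)
    (fun x F => by
      calc ∑ n ∈ F, (L x n * w n) ^ 2
          = ∑ n ∈ F, ((B (κ n)).right n * w n) ^ 2 * x.seq (κ n) ^ 2 :=
            Finset.sum_congr rfl fun n _ => by
              change ((B (κ n)).right n * x.seq (κ n) * w n) ^ 2 = _
              ring
        _ = ∑ j ∈ F.image κ, ∑ n ∈ F with κ n = j,
              ((B (κ n)).right n * w n) ^ 2 * x.seq (κ n) ^ 2 :=
            (Finset.sum_fiberwise_of_maps_to (fun n hn => Finset.mem_image_of_mem κ hn) _).symm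
        _ ≤ ∑ j ∈ F.image κ, 2 ^ 2 * (x.seq j * w j) ^ 2 := Finset.sum_le_sum fun j _ => by
            have e : ∑ n ∈ F with κ n = j, ((B (κ n)).right n * w n) ^ 2 * x.seq (κ n) ^ 2 =
                (∑ n ∈ F with κ n = j, ((B j).right n * w n) ^ 2) * x.seq j ^ 2 := by
              rw [Finset.sum_mul]
              refine Finset.sum_congr rfl fun n hn => ?_
              rw [(Finset.mem_filter.1 hn).2]
            rw [e]
            refine (mul_le_mul_of_nonneg_right ((hB j).sum_right_sq_le_of_finset _)
              (sq_nonneg _)).trans (le_of_eq ?_)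
            ring
        _ = 2 ^ 2 * ∑ j ∈ F.image κ, (x.seq j * w j) ^ 2 := by rw [Finset.mul_sum]
        _ ≤ 2 ^ 2 * ‖x‖ ^ 2 := mul_le_mul_of_nonneg_left (sum_sq_le_norm_sq x _) (by norm_num)
        _ = (2 * ‖x‖) ^ 2 := by ring)
  refine ⟨J, fun j => seq_injective fun n => ?_⟩
  rw [hJ, (hB j).seq_vector]
  change (B (κ n)).right n * (unitVector p w j).seq (κ n) = _
  rw [seq_unitVector]
  by_cases hn : n ∈ (B j).support
  · rw [hκ j n hn]
    simp
  · rw [(hB j).right_eq_zero n hn]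
    split_ifs with h
    · rw [h, (hB j).right_eq_zero n hn, zero_mul]
    · rw [mul_zero]

/-- The operator whose coordinates are the functionals of a disjoint sequence of blocks. -/
lemma exists_analysis (hB : ∀ j, (B j).IsAdapted p w (w j))
    (hdisj : Pairwise fun i j => Disjoint (B i).support (B j).support) :
    ∃ P : RosenthalX p w →L[ℝ] RosenthalX p w,
      ∀ x i, (P x).seq i = (B i).functional p w x := by
  classical
  have hp0 : 0 < p := by linarith [hp.out]
  let L : RosenthalX p w →ₗ[ℝ] (ℕ → ℝ) :=
    { toFun := fun x i => (B i).functional p w x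
      map_add' := fun x y => funext fun i => map_add _ x y
      map_smul' := fun c x => funext fun i => map_smul _ c x }
  have hd : ∀ F : Finset ℕ, (F : Set ℕ).PairwiseDisjoint fun i => (B i).support :=
    fun F i _ j _ hij => hdisj hij
  refine exists_continuousLinearMap L zero_le_one (fun x F => ?_) fun x F => ?_
  · calc ∑ i ∈ F, |L x i| ^ p ≤ ∑ i ∈ F, ∑ n ∈ (B i).support, |x.seq n| ^ p :=
          Finset.sum_le_sum fun i _ => by
            change |(B i).functional p w x| ^ p ≤ _
            rw [Block.functional_apply]
            exact (hB i).left_rpow_le x.seq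
      _ = ∑ n ∈ F.biUnion fun i => (B i).support, |x.seq n| ^ p :=
          (Finset.sum_biUnion (hd F)).symm
      _ ≤ (1 * ‖x‖) ^ p := by
          rw [one_mul]
          exact sum_rpow_le_norm_rpow x _
  · calc ∑ i ∈ F, (L x i * w i) ^ 2 ≤ ∑ i ∈ F, ∑ n ∈ (B i).support, (x.seq n * w n) ^ 2 :=
          Finset.sum_le_sum fun i _ => by
            change ((B i).functional p w x * w i) ^ 2 ≤ _
            rw [Block.functional_apply]
            exact (hB i).left_sq_le x.seq
      _ = ∑ n ∈ F.biUnion fun i => (B i).support, (x.seq n * w n) ^ 2 :=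
          (Finset.sum_biUnion (hd F)).symm
      _ ≤ (1 * ‖x‖) ^ 2 := by
          rw [one_mul]
          exact sum_sq_le_norm_sq x _

/-- The diagonal operator with entries bounded by `C`. -/
lemma exists_multiplier {d : ℕ → ℝ} {C : ℝ} (hd : ∀ n, |d n| ≤ C) :
    ∃ D : RosenthalX p w →L[ℝ] RosenthalX p w, ∀ x n, (D x).seq n = d n * x.seq n := by
  have hp0 : 0 < p := by linarith [hp.out]
  have hC : 0 ≤ C := (abs_nonneg _).trans (hd 0)
  let L : RosenthalX p w →ₗ[ℝ] (ℕ → ℝ) :=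
    { toFun := fun x n => d n * x.seq n
      map_add' := fun x y => funext fun n => by simp [mul_add]
      map_smul' := fun c x => funext fun n => by simp [mul_left_comm] }
  refine exists_continuousLinearMap L hC (fun x F => ?_) fun x F => ?_
  · rw [Real.mul_rpow hC (norm_nonneg _)]
    refine le_trans ?_ (mul_le_mul_of_nonneg_left (sum_rpow_le_norm_rpow x F)
      (Real.rpow_nonneg hC p))
    rw [Finset.mul_sum]
    refine Finset.sum_le_sum fun n _ => ?_
    change |d n * x.seq n| ^ p ≤ _
    rw [abs_mul, Real.mul_rpow (abs_nonneg _) (abs_nonneg _)]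
    exact mul_le_mul_of_nonneg_right (Real.rpow_le_rpow (abs_nonneg _) (hd n) hp0.le)
      (Real.rpow_nonneg (abs_nonneg _) _)
  · rw [mul_pow]
    refine le_trans ?_ (mul_le_mul_of_nonneg_left (sum_sq_le_norm_sq x F) (sq_nonneg C))
    rw [Finset.mul_sum]
    refine Finset.sum_le_sum fun n _ => ?_
    change (d n * x.seq n * w n) ^ 2 ≤ _
    rw [mul_assoc, mul_pow]
    exact mul_le_mul_of_nonneg_right (sq_le_sq.2 ((hd n).trans (le_abs_self C))) (sq_nonneg _)

/-- An operator whose diagonal is bounded away from zero and whose off-diagonal entries are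
summably small has a left inverse: after division by the diagonal it is within `1 / 2` of the
identity. -/
lemma exists_leftInverse_of_small_offDiagonal {W δ : ℝ} (hW : 1 ≤ W) (hwW : ∀ n, |w n| ≤ W)
    (hδ : 0 < δ) (M : RosenthalX p w →L[ℝ] RosenthalX p w)
    (hdiag : ∀ j, δ ≤ |(M (unitVector p w j)).seq j|)
    (hoff : ∀ i j, i ≠ j →
      |(M (unitVector p w j)).seq i| ≤ δ / (8 * W) * ((1 / 2) ^ i * (1 / 2) ^ j)) :
    ∃ A : RosenthalX p w →L[ℝ] RosenthalX p w, A ∘L M = ContinuousLinearMap.id ℝ _ := by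
  have hW0 : 0 < W := by linarith
  have hd : ∀ n, |((M (unitVector p w n)).seq n)⁻¹| ≤ δ⁻¹ := fun n => by
    rw [abs_inv]
    exact inv_anti₀ hδ (hdiag n)
  obtain ⟨D, hD⟩ := exists_multiplier (p := p) (w := w) hd
  set R : RosenthalX p w →L[ℝ] RosenthalX p w := ContinuousLinearMap.id ℝ _ - D ∘L M with hR
  have hRentry : ∀ i j,
      |(R (unitVector p w j)).seq i| ≤ 1 / (8 * W) * ((1 / 2) ^ i * (1 / 2) ^ j) := fun i j => by
    have e : (R (unitVector p w j)).seq i = (unitVector p w j).seq i -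
        ((M (unitVector p w i)).seq i)⁻¹ * (M (unitVector p w j)).seq i := by
      rw [← hD]
      rfl
    rw [e, seq_unitVector]
    by_cases hij : i = j
    · subst hij
      have h0 : (M (unitVector p w i)).seq i ≠ 0 := abs_pos.1 (hδ.trans_le (hdiag i))
      rw [if_pos rfl, inv_mul_cancel₀ h0, sub_self, abs_zero]
      positivity
    · rw [if_neg hij, zero_sub, abs_neg, abs_mul]
      refine (mul_le_mul (hd i) (hoff i j hij) (abs_nonneg _) (by positivity)).trans
        (le_of_eq ?_)
      field_simp
  have hgeo : HasSum (fun n : ℕ => (1 / 2 : ℝ) ^ n) 2 := hasSum_geometric_two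
  have hRcol : ∀ j, ‖R (unitVector p w j)‖ ≤ 1 / 4 * (1 / 2) ^ j := fun j => by
    rw [← (hasSum_unitVector p w (R (unitVector p w j))).tsum_eq]
    have hs : HasSum (fun i : ℕ => (1 / 8 * (1 / 2 : ℝ) ^ j) * (1 / 2) ^ i)
        (1 / 4 * (1 / 2) ^ j) := by
      have h := hgeo.mul_left (1 / 8 * (1 / 2 : ℝ) ^ j)
      rwa [show 1 / 8 * (1 / 2 : ℝ) ^ j * 2 = 1 / 4 * (1 / 2) ^ j by ring] at h
    refine tsum_of_norm_bounded hs fun i => ?_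
    rw [norm_smul, Real.norm_eq_abs]
    refine (mul_le_mul (hRentry i j) (norm_unitVector_le hW hwW i) (norm_nonneg _)
      (by positivity)).trans (le_of_eq ?_)
    field_simp
  have hRnorm : ‖R‖ ≤ 1 / 2 := by
    refine R.opNorm_le_bound (by norm_num) fun x => ?_
    have hx := (hasSum_unitVector p w x).mapL R
    rw [← hx.tsum_eq]
    have hs : HasSum (fun j : ℕ => (‖x‖ * (1 / 4)) * (1 / 2 : ℝ) ^ j) (1 / 2 * ‖x‖) := by
      have h := hgeo.mul_left (‖x‖ * (1 / 4))
      rwa [show ‖x‖ * (1 / 4) * 2 = 1 / 2 * ‖x‖ by ring] at h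
    refine tsum_of_norm_bounded hs fun j => ?_
    rw [map_smul, norm_smul, Real.norm_eq_abs, mul_assoc]
    exact mul_le_mul (abs_seq_le_norm x j) (hRcol j) (norm_nonneg _) (norm_nonneg _)
  have hunit : IsUnit (1 - R) := isUnit_one_sub_of_norm_lt_one (by linarith)
  obtain ⟨U, hU⟩ := hunit.exists_left_inv
  refine ⟨U ∘L D, ?_⟩
  have e : 1 - R = D ∘L M := by
    rw [hR]
    exact sub_sub_cancel _ _
  rw [e] at hU
  exact hU

end Operators

/-! ### Existence of adapted blocks -/

/-- Finite sums over a non-summable set of terms that tend to zero hit every target up to a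
factor `2`, and this off any finite set. -/
lemma exists_finset_sum_mem_Icc {u : ℕ → ℝ} (hu : ∀ n, 0 ≤ u n) (hu0 : Tendsto u atTop (𝓝 0))
    {N : Set ℕ} (hN : ¬ Summable (N.indicator u)) {t : ℝ} (ht : 0 < t) (K : Finset ℕ) :
    ∃ E : Finset ℕ, (∀ n ∈ E, n ∈ N) ∧ Disjoint E K ∧ t ≤ ∑ n ∈ E, u n ∧
      ∑ n ∈ E, u n ≤ 2 * t := by
  classical
  obtain ⟨m, hm⟩ := eventually_atTop.1 (hu0.eventually (gt_mem_nhds ht))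
  set K' := K ∪ Finset.range m with hK'
  obtain ⟨G, hGN, hGK, hG⟩ : ∃ G : Finset ℕ, (∀ n ∈ G, n ∈ N) ∧ Disjoint G K' ∧
      t ≤ ∑ n ∈ G, u n := by
    by_contra! hcon
    refine hN (summable_of_sum_le (c := t + ∑ n ∈ K', u n)
      (fun n => Set.indicator_nonneg (fun n _ => hu n) n) fun F => ?_)
    have h1 : ∑ n ∈ F, N.indicator u n = ∑ n ∈ F with n ∈ N, u n := by
      rw [Finset.sum_filter]
      exact Finset.sum_congr rfl fun n _ => by rw [Set.indicator_apply]
    have h2 := hcon ((F.filter (· ∈ N)) \ K')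
      (fun n hn => (Finset.mem_filter.1 (Finset.mem_sdiff.1 hn).1).2) Finset.sdiff_disjoint
    rw [h1]
    calc ∑ n ∈ F with n ∈ N, u n ≤ ∑ n ∈ (F.filter (· ∈ N)) \ K' ∪ K', u n :=
          Finset.sum_le_sum_of_subset_of_nonneg
            (by rw [Finset.sdiff_union_self_eq_union]; exact Finset.subset_union_left)
            fun n _ _ => hu n
      _ = ∑ n ∈ (F.filter (· ∈ N)) \ K', u n + ∑ n ∈ K', u n :=
          Finset.sum_union Finset.sdiff_disjoint
      _ ≤ t + ∑ n ∈ K', u n := by linarith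
  -- The partial sum in which `t` is passed for the first time overshoots by one term at most.
  have key : ∀ G : Finset ℕ, (∀ n ∈ G, u n ≤ t) → t ≤ ∑ n ∈ G, u n →
      ∃ E ⊆ G, t ≤ ∑ n ∈ E, u n ∧ ∑ n ∈ E, u n ≤ 2 * t := by
    intro G
    induction G using Finset.induction_on with
    | empty =>
      intro _ h
      rw [Finset.sum_empty] at h
      linarith
    | insert a G ha ih =>
      intro hle h
      by_cases h' : t ≤ ∑ n ∈ G, u n
      · obtain ⟨E, hE, hE'⟩ := ih (fun n hn => hle n (Finset.mem_insert_of_mem hn)) h'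
        exact ⟨E, hE.trans (Finset.subset_insert _ _), hE'⟩
      · refine ⟨insert a G, subset_rfl, h, ?_⟩
        rw [Finset.sum_insert ha]
        linarith [hle a (Finset.mem_insert_self _ _)]
  obtain ⟨E, hEG, hE⟩ := key G (fun n hn => by
    refine (hm n ?_).le
    by_contra hlt
    exact Finset.disjoint_left.1 hGK hn
      (Finset.mem_union_right _ (Finset.mem_range.2 (not_le.1 hlt)))) hG
  exact ⟨E, fun n hn => hGN n (hEG hn),
    (hGK.mono_left hEG).mono_right Finset.subset_union_left, hE⟩

/-- Signs can be chosen so that the off-diagonal terms of a quadratic form add up to a nonnegative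
number. -/
lemma exists_signs_sum_diag_le (c : ℕ → ℕ → ℝ) (E : Finset ℕ) :
    ∃ σ : ℕ → ℝ, (∀ n, |σ n| = 1) ∧
      ∑ n ∈ E, c n n ≤ ∑ n ∈ E, ∑ m ∈ E, σ n * σ m * c n m := by
  classical
  induction E using Finset.induction_on with
  | empty => exact ⟨fun _ => 1, by simp, by simp⟩
  | insert a E ha ih =>
    obtain ⟨σ, hσ, h⟩ := ih
    set X := ∑ m ∈ E, σ m * (c a m + c m a) with hX
    obtain ⟨e, he, heX⟩ : ∃ e : ℝ, |e| = 1 ∧ 0 ≤ e * X := by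
      rcases le_total 0 X with h0 | h0
      · exact ⟨1, by simp, by linarith⟩
      · exact ⟨-1, by simp, by linarith⟩
    have hee : e * e = 1 := by rw [← abs_mul_abs_self, he, one_mul]
    refine ⟨Function.update σ a e, fun n => ?_, ?_⟩
    · by_cases hn : n = a
      · subst hn; simpa using he
      · simpa [hn] using hσ n
    · have hne : ∀ n ∈ E, Function.update σ a e n = σ n := fun n hn => by
        rw [Function.update_of_ne]
        rintro rfl
        exact ha hn
      have e1 : ∑ n ∈ E, ∑ m ∈ E, Function.update σ a e n * Function.update σ a e m * c n m =
          ∑ n ∈ E, ∑ m ∈ E, σ n * σ m * c n m :=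
        Finset.sum_congr rfl fun n hn => Finset.sum_congr rfl fun m hm => by
          rw [hne n hn, hne m hm]
      have e2 : ∑ m ∈ E, Function.update σ a e a * Function.update σ a e m * c a m +
          ∑ n ∈ E, Function.update σ a e n * Function.update σ a e a * c n a = e * X := by
        rw [hX, Finset.mul_sum, ← Finset.sum_add_distrib]
        refine Finset.sum_congr rfl fun n hn => ?_
        rw [hne n hn, Function.update_self]
        ring
      simp only [Finset.sum_insert ha, Finset.sum_add_distrib]
      rw [e1]
      have e3 : Function.update σ a e a * Function.update σ a e a * c a a = c a a := by
        rw [Function.update_self, hee, one_mul]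
      rw [e3]
      linarith

/-- For coefficients `θ` with `θ ^ p = (θ w) ^ 2`, the signed normalization of `∑ σ n θ n e n` over
a finite set `E` is a block adapted to every weight comparable with `s ^ (1 / 2 - 1 / p)`, where
`s = ∑ (θ n w n) ^ 2`. -/
lemma isAdapted_of_sum_mem_Icc (hp : 2 < p) {θ σ : ℕ → ℝ} (hw : ∀ n, 0 < w n) (hθ : ∀ n, 0 < θ n)
    (hθw : ∀ n, θ n ^ p = (θ n * w n) ^ 2) (hσ : ∀ n, |σ n| = 1) (E : Finset ℕ) {v s : ℝ}
    (hv : 0 < v) (hs : s = ∑ n ∈ E, (θ n * w n) ^ 2)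
    (hvs : v ^ (2 * p / (p - 2)) ≤ s) (hsv : s ≤ 2 * v ^ (2 * p / (p - 2))) :
    Block.IsAdapted p w v
      { support := E
        left := fun n => s ^ (1 / p - 1) * (σ n * (θ n * w n ^ 2))
        right := fun n => if n ∈ E then s ^ (-(1 / p)) * (σ n * θ n) else 0 } := by
  have hp0 : 0 < p := by linarith
  have hs0 : 0 < s := (Real.rpow_pos_of_pos hv _).trans_le hvs
  have hexp : 0 < 1 - 2 / p := by
    rw [sub_pos, div_lt_one hp0]
    exact hp
  have hvpow : (v ^ (2 * p / (p - 2))) ^ (1 - 2 / p) = v ^ 2 := by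
    rw [← Real.rpow_mul hv.le, ← Real.rpow_natCast]
    congr 1
    have : p - 2 ≠ 0 := by linarith
    push_cast
    field_simp
  have hσ2 : ∀ n, σ n ^ 2 = 1 := fun n => by rw [← sq_abs, hσ n, one_pow]
  refine ⟨fun n hn => if_neg hn, ?_, ?_, fun x => ?_, fun x => ?_⟩
  · have e : ∀ n ∈ E, |if n ∈ E then s ^ (-(1 / p)) * (σ n * θ n) else 0| ^ p =
        s⁻¹ * (θ n * w n) ^ 2 := fun n hn => by
      rw [if_pos hn, abs_mul, abs_mul, hσ, one_mul, abs_of_pos (hθ n),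
        abs_of_pos (Real.rpow_pos_of_pos hs0 _), Real.mul_rpow (Real.rpow_nonneg hs0.le _)
        (hθ n).le, ← Real.rpow_mul hs0.le, hθw, ← Real.rpow_neg_one]
      congr 2
      field_simp
    rw [Finset.sum_congr rfl e, ← Finset.mul_sum, ← hs, inv_mul_cancel₀ hs0.ne']
  · have e : ∀ n ∈ E, ((if n ∈ E then s ^ (-(1 / p)) * (σ n * θ n) else 0) * w n) ^ 2 =
        s ^ (-(2 / p)) * (θ n * w n) ^ 2 := fun n hn => by
      have : s ^ (-(2 / p)) = (s ^ (-(1 / p))) ^ 2 := by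
        rw [← Real.rpow_natCast, ← Real.rpow_mul hs0.le]
        congr 1
        push_cast
        ring
      rw [if_pos hn, this]
      calc (s ^ (-(1 / p)) * (σ n * θ n) * w n) ^ 2
          = σ n ^ 2 * ((s ^ (-(1 / p))) ^ 2 * (θ n * w n) ^ 2) := by ring
        _ = _ := by rw [hσ2, one_mul]
    dsimp only
    rw [Finset.sum_congr rfl e, ← Finset.mul_sum, ← hs]
    calc s ^ (-(2 / p)) * s = s ^ (1 - 2 / p) := by
          rw [← Real.rpow_add_one hs0.ne']
          congr 1
          ring
      _ ≤ (2 * v ^ (2 * p / (p - 2))) ^ (1 - 2 / p) := Real.rpow_le_rpow hs0.le hsv hexp.le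
      _ = 2 ^ (1 - 2 / p) * v ^ 2 := by
          rw [Real.mul_rpow zero_le_two (Real.rpow_nonneg hv.le _), hvpow]
      _ ≤ 2 ^ 2 * v ^ 2 := by
          refine mul_le_mul_of_nonneg_right ?_ (sq_nonneg v)
          rw [← Real.rpow_natCast 2 2]
          refine Real.rpow_le_rpow_of_exponent_le one_le_two ?_
          have : 0 < 2 / p := by positivity
          push_cast
          linarith
      _ = (2 * v) ^ 2 := by ring
  · -- Hölder's inequality with weights `θ ^ p`, applied to `|x| / θ`.
    have hol := Real.inner_le_weight_mul_Lp_of_nonneg E (p := p) (by linarith)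
      (fun n => (θ n * w n) ^ 2) (fun n => |x n| / θ n) (fun n => sq_nonneg _)
      (fun n => div_nonneg (abs_nonneg _) (hθ n).le)
    have e : ∀ n ∈ E, (θ n * w n) ^ 2 * (|x n| / θ n) ^ p = |x n| ^ p := fun n _ => by
      rw [← hθw, Real.div_rpow (abs_nonneg _) (hθ n).le,
        mul_div_cancel₀ _ (Real.rpow_pos_of_pos (hθ n) p).ne']
    rw [Finset.sum_congr rfl e, ← hs] at hol
    have hA : |∑ n ∈ E, s ^ (1 / p - 1) * (σ n * (θ n * w n ^ 2)) * x n| ≤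
        (∑ n ∈ E, |x n| ^ p) ^ p⁻¹ := by
      calc |∑ n ∈ E, s ^ (1 / p - 1) * (σ n * (θ n * w n ^ 2)) * x n|
          ≤ ∑ n ∈ E, |s ^ (1 / p - 1) * (σ n * (θ n * w n ^ 2)) * x n| :=
            Finset.abs_sum_le_sum_abs _ _
        _ = s ^ (1 / p - 1) * ∑ n ∈ E, (θ n * w n) ^ 2 * (|x n| / θ n) := by
            rw [Finset.mul_sum]
            refine Finset.sum_congr rfl fun n _ => ?_
            have := (hθ n).ne'
            rw [abs_mul, abs_mul, abs_mul, hσ, one_mul, abs_of_pos (Real.rpow_pos_of_pos hs0 _),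
              abs_of_pos (mul_pos (hθ n) (pow_pos (hw n) 2))]
            field_simp
        _ ≤ s ^ (1 / p - 1) * (s ^ (1 - p⁻¹) * (∑ n ∈ E, |x n| ^ p) ^ p⁻¹) :=
            mul_le_mul_of_nonneg_left hol (Real.rpow_nonneg hs0.le _)
        _ = (∑ n ∈ E, |x n| ^ p) ^ p⁻¹ := by
            rw [← mul_assoc, ← Real.rpow_add hs0,
              show 1 / p - 1 + (1 - p⁻¹) = 0 by ring, Real.rpow_zero, one_mul]
    have h0 : 0 ≤ ∑ n ∈ E, |x n| ^ p :=
      Finset.sum_nonneg fun n _ => Real.rpow_nonneg (abs_nonneg _) _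
    calc |∑ n ∈ E, s ^ (1 / p - 1) * (σ n * (θ n * w n ^ 2)) * x n| ^ p
        ≤ ((∑ n ∈ E, |x n| ^ p) ^ p⁻¹) ^ p := Real.rpow_le_rpow (abs_nonneg _) hA hp0.le
      _ = ∑ n ∈ E, |x n| ^ p := Real.rpow_inv_rpow h0 hp0.ne'
  · have e : ∑ n ∈ E, s ^ (1 / p - 1) * (σ n * (θ n * w n ^ 2)) * x n =
        s ^ (1 / p - 1) * ∑ n ∈ E, (σ n * (θ n * w n)) * (x n * w n) := by
      rw [Finset.mul_sum]
      exact Finset.sum_congr rfl fun n _ => by ring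
    have cs := Finset.sum_mul_sq_le_sq_mul_sq E (fun n => σ n * (θ n * w n)) fun n => x n * w n
    have e2 : ∑ n ∈ E, (σ n * (θ n * w n)) ^ 2 = s := by
      rw [hs]
      exact Finset.sum_congr rfl fun n _ => by rw [mul_pow, hσ2, one_mul]
    rw [e2] at cs
    have hvs2 : v ^ 2 ≤ s ^ (1 - 2 / p) := by
      rw [← hvpow]
      exact Real.rpow_le_rpow (Real.rpow_nonneg hv.le _) hvs hexp.le
    have hpow : (s ^ (1 / p - 1)) ^ 2 * s * s ^ (1 - 2 / p) = 1 := by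
      rw [← Real.rpow_natCast, ← Real.rpow_mul hs0.le, ← Real.rpow_add_one hs0.ne',
        ← Real.rpow_add hs0]
      rw [show (1 / p - 1) * ((2 : ℕ) : ℝ) + 1 + (1 - 2 / p) = 0 by push_cast; ring,
        Real.rpow_zero]
    have h0 : 0 ≤ ∑ n ∈ E, (x n * w n) ^ 2 := Finset.sum_nonneg fun n _ => sq_nonneg _
    dsimp only
    rw [e]
    calc (s ^ (1 / p - 1) * (∑ n ∈ E, σ n * (θ n * w n) * (x n * w n)) * v) ^ 2
        = (s ^ (1 / p - 1)) ^ 2 * (∑ n ∈ E, σ n * (θ n * w n) * (x n * w n)) ^ 2 * v ^ 2 := by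
          ring
      _ ≤ (s ^ (1 / p - 1)) ^ 2 * (s * ∑ n ∈ E, (x n * w n) ^ 2) * s ^ (1 - 2 / p) :=
          mul_le_mul (mul_le_mul_of_nonneg_left cs (sq_nonneg _)) hvs2 (sq_nonneg _)
            (by positivity)
      _ = ((s ^ (1 / p - 1)) ^ 2 * s * s ^ (1 - 2 / p)) * ∑ n ∈ E, (x n * w n) ^ 2 := by ring
      _ = ∑ n ∈ E, (x n * w n) ^ 2 := by rw [hpow, one_mul]

/-- If the diagonal entries of `S` are at least `δ` on a set over which the weight powers are not
summable, there are blocks adapted to any weight, off any finite set, at which the diagonal entry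
of `S` is again at least `δ`. -/
lemma exists_block [hp : Fact (2 < p)] (hw : StarProperty p w)
    (S : RosenthalX p w →L[ℝ] RosenthalX p w) {δ : ℝ} {N : Set ℕ}
    (hN : ¬ Summable (N.indicator fun n => w n ^ (2 * p / (p - 2))))
    (hS : ∀ n ∈ N, δ ≤ (S (unitVector p w n)).seq n) {v : ℝ} (hv : 0 < v) (K : Finset ℕ) :
    ∃ B : Block, B.IsAdapted p w v ∧ Disjoint B.support K ∧
      δ ≤ B.functional p w (S (B.vector p w)) := by
  have hp2 : 2 < p := hp.out
  have hp0 : 0 < p := by linarith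
  have hpm : 0 < p - 2 := by linarith
  have hr : 0 < 2 * p / (p - 2) := by positivity
  set θ : ℕ → ℝ := fun n => w n ^ (2 / (p - 2)) with hθdef
  have hθ : ∀ n, 0 < θ n := fun n => Real.rpow_pos_of_pos (hw.pos n) _
  have hθp : ∀ n, θ n ^ p = w n ^ (2 * p / (p - 2)) := fun n => by
    rw [hθdef, ← Real.rpow_mul (hw.pos n).le]
    congr 1
    ring
  have hθw' : ∀ n, (θ n * w n) ^ 2 = w n ^ (2 * p / (p - 2)) := fun n => by
    rw [hθdef, ← Real.rpow_add_one (hw.pos n).ne', ← Real.rpow_natCast,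
      ← Real.rpow_mul (hw.pos n).le]
    congr 1
    push_cast
    field_simp
    ring
  have hu0 : Tendsto (fun n => w n ^ (2 * p / (p - 2))) atTop (𝓝 0) := by
    have h := hw.tendsto_zero.rpow_const (p := 2 * p / (p - 2)) (Or.inr hr.le)
    rwa [Real.zero_rpow hr.ne'] at h
  obtain ⟨E, hEN, hEK, hE1, hE2⟩ := exists_finset_sum_mem_Icc
    (fun n => Real.rpow_nonneg (hw.pos n).le _) hu0 hN
    (Real.rpow_pos_of_pos hv (2 * p / (p - 2))) K
  simp only [← hθw'] at hE1 hE2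
  set s := ∑ n ∈ E, (θ n * w n) ^ 2 with hs
  have hs0 : 0 < s := (Real.rpow_pos_of_pos hv _).trans_le hE1
  obtain ⟨σ, hσ, hsign⟩ := exists_signs_sum_diag_le
    (fun n m => θ n * w n ^ 2 * θ m * (S (unitVector p w m)).seq n) E
  refine ⟨_, isAdapted_of_sum_mem_Icc hp2 hw.pos hθ (fun n => (hθp n).trans (hθw' n).symm) hσ E hv
    hs hE1 hE2, hEK, ?_⟩
  have hpow : s ^ (1 / p - 1) * s ^ (-(1 / p)) = s⁻¹ := by
    rw [← Real.rpow_add hs0, ← Real.rpow_neg_one]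
    congr 1
    ring
  have hentry : ∀ n, (S (∑ m ∈ E, (if m ∈ E then s ^ (-(1 / p)) * (σ m * θ m) else 0) •
      unitVector p w m)).seq n =
      s ^ (-(1 / p)) * ∑ m ∈ E, σ m * θ m * (S (unitVector p w m)).seq n := fun n => by
    rw [map_sum, seq_sum, Finset.mul_sum]
    refine Finset.sum_congr rfl fun m hm => ?_
    rw [if_pos hm, map_smul, seq_smul]
    ring
  rw [Block.functional_apply, Block.vector]
  dsimp only
  have e : ∑ n ∈ E, s ^ (1 / p - 1) * (σ n * (θ n * w n ^ 2)) *
      (S (∑ m ∈ E, (if m ∈ E then s ^ (-(1 / p)) * (σ m * θ m) else 0) •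
        unitVector p w m)).seq n =
      s⁻¹ * ∑ n ∈ E, ∑ m ∈ E,
        σ n * σ m * (θ n * w n ^ 2 * θ m * (S (unitVector p w m)).seq n) := by
    rw [← hpow, Finset.mul_sum]
    refine Finset.sum_congr rfl fun n _ => ?_
    rw [hentry, Finset.mul_sum, Finset.mul_sum, Finset.mul_sum]
    exact Finset.sum_congr rfl fun m _ => by ring
  rw [e, inv_mul_eq_div, le_div_iff₀ hs0]
  refine le_trans ?_ hsign
  rw [hs, Finset.mul_sum]
  refine Finset.sum_le_sum fun n hn => ?_
  calc δ * (θ n * w n) ^ 2 ≤ (S (unitVector p w n)).seq n * (θ n * w n) ^ 2 :=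
        mul_le_mul_of_nonneg_right (hS n (hEN n hn)) (sq_nonneg _)
    _ = θ n * w n ^ 2 * θ n * (S (unitVector p w n)).seq n := by ring

/-! ### Factors of the identity -/

/-- Recursive choice of a sequence whose `n`-th term satisfies a condition relative to each of the
earlier terms. -/
lemma exists_seq_of_forall_prefix {α : Type*} [Inhabited α] {P : ℕ → α → Prop}
    {r : ℕ → ℕ → α → α → Prop}
    (h : ∀ n, ∀ s : ℕ → α, ∃ y, P n y ∧ ∀ m < n, r m n (s m) y) :
    ∃ f : ℕ → α, (∀ n, P n (f n)) ∧ ∀ m n, m < n → r m n (f m) (f n) := by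
  choose F hP hr using h
  let step : ∀ n : ℕ, (∀ m, m < n → α) → α :=
    fun n g => F n fun m => if hm : m < n then g m hm else default
  let f : ℕ → α := Nat.lt_wfRel.wf.fix step
  have hf : ∀ n, f n = F n fun m => if m < n then f m else default := fun n => by
    have := Nat.lt_wfRel.wf.fix_eq step n
    simpa [step] using this
  refine ⟨f, fun n => ?_, fun m n hmn => ?_⟩
  · rw [hf]
    exact hP n _
  · have := hr n (fun m => if m < n then f m else default) m hmn
    rw [hf n]
    simpa [hmn] using this

section Factorization

variable [hp : Fact (2 < p)]

/-- An operator whose diagonal entries are at least `δ` on a set over which the weight powers are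
not summable is a factor of the identity. A gliding hump yields disjoint blocks, the `j`-th adapted
to the weight `w j`, on which the operator is almost diagonal. -/
lemma isFactorOfIdentity_of_le_diag (hw : StarProperty p w)
    (S : RosenthalX p w →L[ℝ] RosenthalX p w) {δ : ℝ} (hδ : 0 < δ) {N : Set ℕ}
    (hN : ¬ Summable (N.indicator fun n => w n ^ (2 * p / (p - 2))))
    (hS : ∀ n ∈ N, δ ≤ (S (unitVector p w n)).seq n) : IsFactorOfIdentity S := by
  classical
  obtain ⟨W, hW, hwW⟩ : ∃ W : ℝ, 1 ≤ W ∧ ∀ n, |w n| ≤ W := by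
    obtain ⟨C, hC⟩ := (Metric.isBounded_range_of_tendsto w hw.tendsto_zero).exists_norm_le
    exact ⟨max 1 C, le_max_left _ _,
      fun n => (hC (w n) (Set.mem_range_self n)).trans (le_max_right _ _)⟩
  have hW0 : 0 < W := by linarith
  let η : ℕ → ℕ → ℝ := fun m n => δ / (8 * W) * ((1 / 2) ^ m * (1 / 2) ^ n)
  have hη : ∀ m n, 0 < η m n := fun m n => by positivity
  have : Inhabited Block := ⟨⟨∅, 0, 0⟩⟩
  obtain ⟨B, hB, hrel⟩ := exists_seq_of_forall_prefix (α := Block)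
    (P := fun n B => B.IsAdapted p w (w n) ∧ δ ≤ B.functional p w (S (B.vector p w)))
    (r := fun m n B B' => Disjoint B.support B'.support ∧
      |B.functional p w (S (B'.vector p w))| ≤ η m n ∧
      |B'.functional p w (S (B.vector p w))| ≤ η m n) (fun n s => by
    -- Off `K₁ m` the functional of the earlier block `s m`, composed with `S`, is small; off
    -- `K₂ m` the image of the vector of `s m` is small.
    choose K₁ hK₁ using fun m => exists_finset_abs_apply_le ((s m).functional p w ∘L S)
      (div_pos (hη m n) (by positivity : 0 < 2 * W))
    have hsec : ∀ m, ∃ K₂ : Finset ℕ, ‖S ((s m).vector p w) -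
        ∑ i ∈ K₂, (S ((s m).vector p w)).seq i • unitVector p w i‖ < η m n := fun m => by
      have h := (Metric.tendsto_nhds.1 (hasSum_unitVector p w (S ((s m).vector p w)))
        (η m n) (hη m n)).exists
      simpa only [dist_comm, dist_eq_norm] using h
    choose K₂ hK₂ using hsec
    obtain ⟨C, hC, hCK, hCδ⟩ := exists_block hw S hN hS (hw.pos n)
      ((Finset.range n).biUnion fun m => (s m).support ∪ (K₁ m ∪ K₂ m))
    refine ⟨C, ⟨hC, hCδ⟩, fun m hm => ?_⟩
    have hdisj := hCK.mono_right
      (Finset.subset_biUnion_of_mem (fun m => (s m).support ∪ (K₁ m ∪ K₂ m))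
        (Finset.mem_range.2 hm))
    rw [Finset.disjoint_union_right, Finset.disjoint_union_right] at hdisj
    obtain ⟨hd, hd₁, hd₂⟩ := hdisj
    refine ⟨hd.symm, ?_, ?_⟩
    · have h := hK₁ m (C.vector p w) fun i hi => by
        rw [hC.seq_vector]
        exact hC.right_eq_zero i fun hi' => Finset.disjoint_left.1 hd₁ hi' hi
      refine h.trans ?_
      rw [div_mul_eq_mul_div, div_le_iff₀ (by positivity)]
      exact mul_le_mul_of_nonneg_left (hC.norm_vector_le hW (hwW n)) (hη m n).le
    · set z := S ((s m).vector p w) with hz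
      have e : C.functional p w z =
          C.functional p w (z - ∑ i ∈ K₂ m, z.seq i • unitVector p w i) := by
        rw [Block.functional_apply, Block.functional_apply]
        refine Finset.sum_congr rfl fun i hi => ?_
        rw [seq_sub, seq_sum_smul_unitVector, if_neg (Finset.disjoint_left.1 hd₂ hi), sub_zero]
      rw [e]
      exact (hC.abs_functional_le _).trans (hK₂ m).le)
  have hdisj : Pairwise fun i j => Disjoint (B i).support (B j).support := by
    intro i j hij
    rcases lt_or_gt_of_ne hij with h | h
    · exact (hrel i j h).1
    · exact (hrel j i h).1.symm
  obtain ⟨J, hJ⟩ := exists_synthesis (fun j => (hB j).1) hdisj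
  obtain ⟨P, hP⟩ := exists_analysis (fun j => (hB j).1) hdisj
  obtain ⟨A, hA⟩ := exists_leftInverse_of_small_offDiagonal hW hwW hδ (P ∘L S ∘L J)
    (fun j => by
      change δ ≤ |(P (S (J (unitVector p w j)))).seq j|
      rw [hP, hJ]
      exact (hB j).2.trans (le_abs_self _))
    (fun i j hij => by
      change |(P (S (J (unitVector p w j)))).seq i| ≤ _
      rw [hP, hJ]
      rcases lt_or_gt_of_ne hij with h | h
      · exact (hrel i j h).2.1
      · rw [mul_comm ((1 / 2 : ℝ) ^ i)]
        exact (hrel j i h).2.2)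
  exact ⟨A ∘L P, J, hA.symm⟩

/-- The unit vector basis of `X_{p,w}` has the factorization property. -/
lemma hasFactorizationProperty_unitVectorBasis (hw : StarProperty p w) :
    HasFactorizationProperty (unitVectorBasis p w) := by
  intro S hS
  obtain ⟨δ, hδ, hdiag⟩ : ∃ δ : ℝ, 0 < δ ∧ ∀ n, δ ≤ |(S (unitVector p w n)).seq n| :=
    ⟨_, hS, fun n => ciInf_le ⟨0, by rintro _ ⟨n, rfl⟩; exact abs_nonneg _⟩ n⟩
  set u : ℕ → ℝ := fun n => w n ^ (2 * p / (p - 2)) with hu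
  set N : Set ℕ := {n | 0 ≤ (S (unitVector p w n)).seq n} with hNdef
  by_cases hN : Summable (N.indicator u)
  · -- The weight powers are not summable where the diagonal is negative, so pass to `-S`.
    have hN' : ¬ Summable (Nᶜ.indicator u) := fun h => hw.not_summable (by
      have := hN.add h
      rwa [← Pi.add_def, Set.indicator_self_add_compl] at this)
    obtain ⟨A, B, h⟩ := isFactorOfIdentity_of_le_diag hw (-S) hδ hN' fun n hn => by
      have h0 : (S (unitVector p w n)).seq n < 0 := not_le.1 hn
      have := hdiag n
      rw [abs_of_neg h0] at this
      exact this
    refine ⟨-A, B, h.trans ?_⟩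
    ext x
    simp
  · exact isFactorOfIdentity_of_le_diag hw S hδ hN fun n hn => by
      have := hdiag n
      rwa [abs_of_nonneg hn] at this

/-- Factorizations pass to adjoints, and by reflexivity the dual basis inherits the factorization
property. -/
lemma hasFactorizationProperty_dualBasis (hw : StarProperty p w) :
    HasFactorizationProperty (dualBasis p w) := by
  intro T hT
  obtain ⟨S, hS⟩ := exists_preadjoint T
  have hdiag : HasLargeDiagonal (unitVectorBasis p w) S := by
    have e : ∀ n, (dualBasis p w).coord n (T (dualBasis p w n)) =
        (unitVectorBasis p w).coord n (S (unitVectorBasis p w n)) := fun n =>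
      hS (coordFunctional p w n) (unitVector p w n)
    simpa only [HasLargeDiagonal, e] using hT
  obtain ⟨A, B, h⟩ := hasFactorizationProperty_unitVectorBasis hw S hdiag
  refine ⟨ContinuousLinearMap.precomp ℝ B, ContinuousLinearMap.precomp ℝ A, ?_⟩
  refine ContinuousLinearMap.ext fun ξ => ContinuousLinearMap.ext fun x => ?_
  change ξ x = T (ξ ∘L A) (B x)
  rw [hS]
  exact congrArg ξ (DFunLike.congr_fun h x)

end Factorization

end RosenthalX

theorem mainTheorem4 (p q : ℝ) [Fact (2 < p)] (hq1 : 1 < q) (hq2 : q < 2)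
    (hpq : p.HolderConjugate q) (w : ℕ → ℝ) (hw : StarProperty p w) :
    ∃ b : SchauderBasis ℝ (StrongDual ℝ (RosenthalX p w)),
      (∀ n, b n = (RosenthalX.unitVectorBasis p w).coord n) ∧ HasFactorizationProperty b :=
  ⟨RosenthalX.dualBasis p w, fun _ => rfl, RosenthalX.hasFactorizationProperty_dualBasis hw⟩
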